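/- Let $G$ be a (finite-dimensional real) Lie group with Lie algebra $\mathcal G$, let $U$ be a strongly continuous unitary representation of $G$ on a separable complex Hilbert space $\mathcal H$, and let $\mathcal D^\infty(U)$ be the space of vectors $\phi\in\mathcal H$ for which $g\mapsto U(g)\phi$ is a $C^\infty$ map. For $x\in\mathcal G$ and $\phi\in\mathcal D^\infty(U)$ put $dU(x)\phi=\lim_{t\to0}t^{-1}(U(\exp tx)-I)\phi$, and let $dU$ also denote the extension of this map to a unital algebra homomorphism from the (complex) enveloping algebra $\mathcal E(\mathcal G)$ into the linear operators on $\mathcal D^\infty(U)$. Write $\mathcal A=dU(\mathcal E(\mathcal G))$. Let $\mathcal T_1(\mathcal A)$ be the set of trace class operators $T$ on $\mathcal H$ such that $T\mathcal H\subseteq\mathcal D^\infty(U)$, $T^*\mathcal H\subseteq\mathcal D^\infty(U)$, and $AT$, $AT^*$ are trace class for every $A\in\mathcal A$. The state space of $\mathcal A$ is the set of positive (in particular self-adjoint) operators $\rho\in\mathcal T_1(\mathcal A)$ with $\mathrm{Tr}\,\rho=1$. Its weak topology is the coarsest topology for which all the functions $\rho\mapsto\mathrm{Tr}(\rho A)$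 (that is, $\mathrm{Tr}(A\rho)$), $A\in\mathcal A$, are continuous. Let $A\in\mathcal A$ be essentially self-adjoint on $\mathcal D^\infty(U)$. Then for every real number $\alpha$ such that $A\neq\alpha I$, the set of states $\rho$ with $\mathrm{Tr}(\rho A)=\alpha$ has empty interior in the weak topology on the state space of $\mathcal A$. -/

import Mathlib

open scoped Manifold ContDiff InnerProductSpace TensorProduct Topology

namespace InfRep

noncomputable section

open VectorField Bundle

variable {E : Type*} [NormedAddCommGroup E] [NormedSpace ℝ E]
  {G : Type*} [TopologicalSpace G] [ChartedSpace E G] [Group G] 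

/-- A smooth Lie group has the regularity that Mathlib asks for to form its Lie algebra. -/
instance lieGroup_minSmoothness [LieGroup 𝓘(ℝ, E) ∞ G] : LieGroup 𝓘(ℝ, E) (minSmoothness ℝ 3) G :=
  LieGroup.of_le (n := ∞) (by
    rw [minSmoothness_of_isRCLikeNormedField]
    exact mod_cast (ENat.LEInfty.out (m := 3)))

variable [LieGroup 𝓘(ℝ, E) ∞ G]
/-- Left-invariant vector fields on a smooth Lie group are smooth. -/
theorem contMDiff_leftInvariant (v : GroupLieAlgebra 𝓘(ℝ, E) G) :
    ContMDiff 𝓘(ℝ, E) 𝓘(ℝ, E).tangent ∞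
      (fun g : G ↦ (TotalSpace.mk' E g (mulInvariantVectorField v g) : TangentBundle 𝓘(ℝ, E) G)) := by
  let fg : G → TangentBundle 𝓘(ℝ, E) G := fun g ↦ TotalSpace.mk' E g 0
  have sfg : ContMDiff 𝓘(ℝ, E) 𝓘(ℝ, E).tangent ∞ fg := contMDiff_zeroSection _ _
  let fv : G → TangentBundle 𝓘(ℝ, E) G := fun _ ↦ TotalSpace.mk' E 1 v
  have sfv : ContMDiff 𝓘(ℝ, E) 𝓘(ℝ, E).tangent ∞ fv := contMDiff_const
  let F₁ : G → (TangentBundle 𝓘(ℝ, E) G × TangentBundle 𝓘(ℝ, E) G) := fun g ↦ (fg g, fv g)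
  have S₁ : ContMDiff 𝓘(ℝ, E) (𝓘(ℝ, E).tangent.prod 𝓘(ℝ, E).tangent) ∞ F₁ := sfg.prodMk sfv
  let F₂ : (TangentBundle 𝓘(ℝ, E) G × TangentBundle 𝓘(ℝ, E) G) →
      TangentBundle (𝓘(ℝ, E).prod 𝓘(ℝ, E)) (G × G) :=
    (equivTangentBundleProd 𝓘(ℝ, E) G 𝓘(ℝ, E) G).symm
  have S₂ := contMDiff_equivTangentBundleProd_symm (I := 𝓘(ℝ, E)) (M := G) (I' := 𝓘(ℝ, E)) (M' := G) (n := ∞)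
  let F₃ : TangentBundle (𝓘(ℝ, E).prod 𝓘(ℝ, E)) (G × G) → TangentBundle 𝓘(ℝ, E) G :=
    tangentMap (𝓘(ℝ, E).prod 𝓘(ℝ, E)) 𝓘(ℝ, E) (fun (p : G × G) ↦ p.1 * p.2)
  have S₃ : ContMDiff (𝓘(ℝ, E).prod 𝓘(ℝ, E)).tangent 𝓘(ℝ, E).tangent ∞ F₃ :=
    ContMDiff.contMDiff_tangentMap (n := ∞) (contMDiff_mul 𝓘(ℝ, E) ∞) (by simp)
  have S := (S₃.comp S₂).comp S₁
  convert! S with g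
  · simp [F₁, F₃, fg, fv]
  · simp only [Function.comp_apply, tangentMap, F₃, F₁, fg, fv]
    rw [mfderiv_prod_eq_add_apply ((contMDiff_mul 𝓘(ℝ, E) ∞).mdifferentiableAt (by simp))]
    change (mfderiv 𝓘(ℝ, E) 𝓘(ℝ, E) (fun x ↦ g * x) 1 v : E) =
      (mfderiv 𝓘(ℝ, E) 𝓘(ℝ, E) (fun x ↦ x * (1 : G)) g (0 : E) : E) +
        (mfderiv 𝓘(ℝ, E) 𝓘(ℝ, E) (fun x ↦ g * x) (1 : G) v : E)
    rw [show (mfderiv 𝓘(ℝ, E) 𝓘(ℝ, E) (fun x ↦ x * (1 : G)) g (0 : E) : E) = 0 from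
      map_zero (mfderiv 𝓘(ℝ, E) 𝓘(ℝ, E) (fun x ↦ x * (1 : G)) g)]
    exact (zero_add _).symm

variable {F : Type*} [NormedAddCommGroup F] [NormedSpace ℝ F]

/-- The differential of a vector-valued function at a point of the group. -/
def diffAt (f : G → F) (g : G) : TangentSpace 𝓘(ℝ, E) g →L[ℝ] F := mfderiv 𝓘(ℝ, E) 𝓘(ℝ, F) f g

/-- Differentiating a smooth function along a Lie bracket of vector fields gives the commutator of
the derivatives along the two fields. -/
theorem diffAt_mlieBracket {f : G → F} (hf : ContMDiff 𝓘(ℝ, E) 𝓘(ℝ, F) ∞ f)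
    [CompleteSpace E]
    {V W : (g : G) → TangentSpace 𝓘(ℝ, E) g} (x₀ : G)
    (hV : MDifferentiableAt 𝓘(ℝ, E) 𝓘(ℝ, E).tangent
      (fun g : G ↦ (TotalSpace.mk' E g (V g) : TangentBundle 𝓘(ℝ, E) G)) x₀)
    (hW : MDifferentiableAt 𝓘(ℝ, E) 𝓘(ℝ, E).tangent
      (fun g : G ↦ (TotalSpace.mk' E g (W g) : TangentBundle 𝓘(ℝ, E) G)) x₀)
    (hfV : MDifferentiableAt 𝓘(ℝ, E) 𝓘(ℝ, F) (fun g ↦ diffAt f g (V g)) x₀)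
    (hfW : MDifferentiableAt 𝓘(ℝ, E) 𝓘(ℝ, F) (fun g ↦ diffAt f g (W g)) x₀) :
    diffAt f x₀ (mlieBracket 𝓘(ℝ, E) V W x₀) =
      diffAt (fun g ↦ diffAt f g (W g)) x₀ (V x₀) -
        diffAt (fun g ↦ diffAt f g (V g)) x₀ (W x₀) := by
  have : IsManifold 𝓘(ℝ, E) ∞ G := inferInstance
  have : IsManifold 𝓘(ℝ, E) 2 G := inferInstance
  have : IsManifold 𝓘(ℝ, E) 1 G := inferInstance
  set e := extChartAt 𝓘(ℝ, E) x₀ with he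
  set y₀ := e x₀ with hy₀
  have hey₀ : e.symm y₀ = x₀ := extChartAt_to_inv x₀
  have hy₀t : y₀ ∈ e.target := mem_extChartAt_target x₀
  have hr : Set.range 𝓘(ℝ, E) = Set.univ := by simp
  have hsymm : ∀ y ∈ e.target, MDifferentiableAt 𝓘(ℝ, E) 𝓘(ℝ, E) e.symm y := fun y hy ↦ by
    have := mdifferentiableWithinAt_extChartAt_symm (I := 𝓘(ℝ, E)) (x := x₀) hy
    rwa [hr, mdifferentiableWithinAt_univ] at this
  have hinv : ∀ y ∈ e.target, (mfderiv 𝓘(ℝ, E) 𝓘(ℝ, E) e.symm y).IsInvertible := fun y hy ↦ by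
    have := isInvertible_mfderivWithin_extChartAt_symm (I := 𝓘(ℝ, E)) (x := x₀) hy
    rwa [hr, mfderivWithin_univ] at this
  have htn : e.target ∈ 𝓝 y₀ := extChartAt_target_mem_nhds x₀
  have key : ∀ {h : G → F} {y : E} (_ : y ∈ e.target)
      (_ : MDifferentiableAt 𝓘(ℝ, E) 𝓘(ℝ, F) h (e.symm y)) (Z : (g : G) → TangentSpace 𝓘(ℝ, E) g),
      fderiv ℝ (h ∘ e.symm) y (mpullbackWithin 𝓘(ℝ, E) 𝓘(ℝ, E) e.symm Z Set.univ y) =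
        diffAt h (e.symm y) (Z (e.symm y)) := by
    intro h y hy hh Z
    rw [← mfderiv_eq_fderiv, mfderiv_comp y hh (hsymm y hy)]
    rw [mpullbackWithin_apply, mfderivWithin_univ]
    obtain ⟨M, hM⟩ := hinv y hy
    have : (mfderiv 𝓘(ℝ, E) 𝓘(ℝ, E) e.symm y)
      ((mfderiv 𝓘(ℝ, E) 𝓘(ℝ, E) e.symm y).inverse (Z (e.symm y))) = Z (e.symm y) := by
      rw [← hM, ContinuousLinearMap.inverse_equiv]
      exact M.apply_symm_apply _
    exact congrArg (mfderiv 𝓘(ℝ, E) 𝓘(ℝ, F) h (e.symm y)) this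
  have hfd : ∀ g, MDifferentiableAt 𝓘(ℝ, E) 𝓘(ℝ, F) f g := fun g ↦
    hf.mdifferentiableAt (by simp)
  -- pulled back fields
  set V' := mpullbackWithin 𝓘(ℝ, E) 𝓘(ℝ, E) e.symm V Set.univ with hV'
  set W' := mpullbackWithin 𝓘(ℝ, E) 𝓘(ℝ, E) e.symm W Set.univ with hW'
  have dV' : DifferentiableAt ℝ V' y₀ := by
    have := MDifferentiableWithinAt.differentiableWithinAt_mpullbackWithin_vectorField
      (mdifferentiableWithinAt_univ.2 hV)
    rw [hr, Set.preimage_univ, Set.univ_inter] at this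
    exact differentiableWithinAt_univ.1 this
  have dW' : DifferentiableAt ℝ W' y₀ := by
    have := MDifferentiableWithinAt.differentiableWithinAt_mpullbackWithin_vectorField
      (mdifferentiableWithinAt_univ.2 hW)
    rw [hr, Set.preimage_univ, Set.univ_inter] at this
    exact differentiableWithinAt_univ.1 this
  have hfs : ContDiffAt ℝ ∞ (f ∘ e.symm) y₀ := by
    have h1 : ContMDiffAt 𝓘(ℝ, E) 𝓘(ℝ, E) ∞ e.symm y₀ := by
      have := contMDiffWithinAt_extChartAt_symm_range (I := 𝓘(ℝ, E)) (n := ∞) x₀ hy₀t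
      rwa [hr, contMDiffWithinAt_univ] at this
    exact (hf.contMDiffAt.comp y₀ h1).contDiffAt
  have main := fderiv_apply_lieBracket hfs
    (by rw [minSmoothness_of_isRCLikeNormedField]; exact mod_cast (ENat.LEInfty.out (m := 2)))
    dW' dV'
  have eqn : ∀ Z : (g : G) → TangentSpace 𝓘(ℝ, E) g,
      (fun y ↦ fderiv ℝ (f ∘ e.symm) y (mpullbackWithin 𝓘(ℝ, E) 𝓘(ℝ, E) e.symm Z Set.univ y))
        =ᶠ[𝓝 y₀] (fun g ↦ diffAt f g (Z g)) ∘ e.symm := by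
    intro Z
    filter_upwards [htn] with y hy
    exact key hy (hfd _) Z
  rw [(eqn W).fderiv_eq, (eqn V).fderiv_eq, key hy₀t (by rwa [hey₀]) V,
    key hy₀t (by rwa [hey₀]) W] at main
  have hx₀s : x₀ ∈ e.source := mem_extChartAt_source x₀
  set L : E := lieBracket ℝ (V' : E → E) (W' : E → E) y₀ with hL
  have hbr : mlieBracket 𝓘(ℝ, E) V W x₀ =
      (mfderiv 𝓘(ℝ, E) 𝓘(ℝ, E) e x₀).inverse L := by
    rw [← mlieBracketWithin_univ, mlieBracketWithin_apply]
    simp only [hr, Set.preimage_univ, Set.univ_inter]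
    have hL' : lieBracketWithin ℝ (V' : E → E) (W' : E → E) Set.univ y₀ = L :=
      congrFun lieBracketWithin_univ y₀
    exact congrArg (mfderiv 𝓘(ℝ, E) 𝓘(ℝ, E) e x₀).inverse hL'
  have hB : mfderiv 𝓘(ℝ, E) 𝓘(ℝ, E) e x₀
      ((mfderiv 𝓘(ℝ, E) 𝓘(ℝ, E) e x₀).inverse L) =
        L := by
    obtain ⟨M, hM⟩ := isInvertible_mfderiv_extChartAt (I := 𝓘(ℝ, E)) hx₀s
    rw [← hM, ContinuousLinearMap.inverse_equiv]
    exact M.apply_symm_apply _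
  have hfe : f =ᶠ[𝓝 x₀] (f ∘ e.symm) ∘ e := by
    filter_upwards [extChartAt_source_mem_nhds (I := 𝓘(ℝ, E)) x₀] with x hx
    exact congrArg f ((extChartAt 𝓘(ℝ, E) x₀).left_inv hx).symm
  have hfin : diffAt f x₀ (mlieBracket 𝓘(ℝ, E) V W x₀) =
      fderiv ℝ (f ∘ e.symm) y₀ L := by
    have h1 : diffAt f x₀ = (fderiv ℝ (f ∘ e.symm) y₀).comp
        (mfderiv 𝓘(ℝ, E) 𝓘(ℝ, E) e x₀) := by
      have h2 : MDifferentiableAt 𝓘(ℝ, E) 𝓘(ℝ, F) (f ∘ e.symm) (e x₀) :=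
        (hfs.differentiableAt (by simp)).mdifferentiableAt
      rw [diffAt, hfe.mfderiv_eq, mfderiv_comp x₀ h2
        (mdifferentiableAt_extChartAt (mem_chart_source E x₀)), mfderiv_eq_fderiv]
      rfl
    rw [h1, hbr]
    exact congrArg (fderiv ℝ (f ∘ e.symm) y₀) hB
  rw [hfin]
  rwa [hey₀] at main


variable {H : Type*} [NormedAddCommGroup H] [InnerProductSpace ℂ H] [CompleteSpace H]

variable (E) in
/-- The space `D^∞(U)` of smooth vectors of a unitary representation `U` of `G`: the vectors `φ`
whose orbit map `g ↦ U(g) φ` is of class `C^∞`. The space `E` is the model space of `G`. -/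
def smoothVectors (U : G →* unitary (H →L[ℂ] H)) : Submodule ℂ H where
  carrier := {φ | ContMDiff 𝓘(ℝ, E) 𝓘(ℝ, H) ∞ fun g : G ↦ (U g : H →L[ℂ] H) φ}
  zero_mem' := by
    simpa using (contMDiff_const : ContMDiff 𝓘(ℝ, E) 𝓘(ℝ, H) ∞ fun _ : G ↦ (0 : H))
  add_mem' {φ ψ} hφ hψ := by
    simpa [Pi.add_def] using ContMDiff.add hφ hψ
  smul_mem' c φ hφ := by
    have h : ContDiff ℝ ∞ fun v : H ↦ c • v := contDiff_const_smul c
    have := h.contMDiff.comp hφ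
    simpa [Function.comp_def] using this

variable (U : G →* unitary (H →L[ℂ] H))

theorem orbit_mdiff (φ : smoothVectors E U) (g : G) :
    MDifferentiableAt 𝓘(ℝ, E) 𝓘(ℝ, H) (fun g : G ↦ (U g : H →L[ℂ] H) φ) g :=
  ContMDiff.mdifferentiableAt φ.2 (by simp)

theorem clm_comp_diffAt (T : H →L[ℂ] H) {f : G → H} {g : G}
    (hf : MDifferentiableAt 𝓘(ℝ, E) 𝓘(ℝ, H) f g) (v : TangentSpace 𝓘(ℝ, E) g) :
    diffAt (fun h ↦ T (f h)) g v = T (diffAt f g v) := by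
  have hT : MDifferentiableAt 𝓘(ℝ, H) 𝓘(ℝ, H) (T.restrictScalars ℝ) (f g) :=
    (T.restrictScalars ℝ).differentiableAt.mdifferentiableAt
  have h := mfderiv_comp g hT hf
  rw [mfderiv_eq_fderiv, ContinuousLinearMap.fderiv] at h
  exact congrArg (fun L : E →L[ℝ] H ↦ L v) h

theorem diffAt_comp_mul {f : G → H} (g : G)
    (hf : MDifferentiableAt 𝓘(ℝ, E) 𝓘(ℝ, H) f g) (v : GroupLieAlgebra 𝓘(ℝ, E) G) :
    diffAt (fun h : G ↦ f (g * h)) 1 v = diffAt f g (mulInvariantVectorField v g) := by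
  have hm : MDifferentiableAt 𝓘(ℝ, E) 𝓘(ℝ, E) (fun h : G ↦ g * h) 1 :=
    (contMDiff_mul_left (I := 𝓘(ℝ, E)) (n := ∞)).mdifferentiableAt (by simp)
  have h := mfderiv_comp_of_eq (x := (1 : G)) (y := g) hf hm (mul_one g)
  have h3 : mfderiv 𝓘(ℝ, E) 𝓘(ℝ, H) (f ∘ fun h : G ↦ g * h) 1 =
      (mfderiv 𝓘(ℝ, E) 𝓘(ℝ, H) f g : E →L[ℝ] H).comp
        (mfderiv 𝓘(ℝ, E) 𝓘(ℝ, E) (fun h : G ↦ g * h) 1 : E →L[ℝ] E) := by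
    rw [h, mul_one]
  exact congrArg (fun L : E →L[ℝ] H ↦ L v) h3

/-- The derivative of an orbit map along a left-invariant vector field. -/
theorem diffAt_orbit (φ : smoothVectors E U) (v : GroupLieAlgebra 𝓘(ℝ, E) G) (g : G) :
    diffAt (fun g : G ↦ (U g : H →L[ℂ] H) φ) g (mulInvariantVectorField v g) =
      (U g : H →L[ℂ] H) (diffAt (fun g : G ↦ (U g : H →L[ℂ] H) φ) 1 v) := by
  rw [← diffAt_comp_mul g (orbit_mdiff U φ g), ← clm_comp_diffAt _ (orbit_mdiff U φ 1)]
  simp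

theorem diffAt_orbit_mem (φ : smoothVectors E U) (v : GroupLieAlgebra 𝓘(ℝ, E) G) :
    diffAt (fun g : G ↦ (U g : H →L[ℂ] H) φ) 1 v ∈ smoothVectors E U := by
  change ContMDiff 𝓘(ℝ, E) 𝓘(ℝ, H) ∞ _
  have h1 : ContMDiff 𝓘(ℝ, E).tangent 𝓘(ℝ, H).tangent ∞
      (tangentMap 𝓘(ℝ, E) 𝓘(ℝ, H) (fun g : G ↦ (U g : H →L[ℂ] H) φ)) :=
    ContMDiff.contMDiff_tangentMap (n := ∞) φ.2 (by simp)
  have h2 := (contMDiff_snd_tangentBundle_modelSpace H 𝓘(ℝ, H) (n := ∞)).comp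
    (h1.comp (contMDiff_leftInvariant v))
  refine h2.congr fun g ↦ ?_
  exact (diffAt_orbit U φ v g).symm

/-- The operator `dU(x)` on `D^∞(U)`, for `x` in the Lie algebra of `G`: it sends `φ` to the
derivative at `1`, in the direction `x`, of the orbit map `g ↦ U(g) φ`. By `tendsto_dU` below this is
the limit of `t⁻¹ (U(exp (t x)) φ - φ)` as `t → 0`. -/
def dU (v : GroupLieAlgebra 𝓘(ℝ, E) G) : Module.End ℂ (smoothVectors E U) where
  toFun φ := ⟨diffAt (fun g : G ↦ (U g : H →L[ℂ] H) φ) 1 v, diffAt_orbit_mem U φ v⟩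
  map_add' φ ψ := by
    apply Subtype.ext
    have h := mfderiv_add (orbit_mdiff U φ 1) (orbit_mdiff U ψ 1)
    have h2 := congrArg (fun L : E →L[ℝ] H ↦ L v) h
    simp only [Submodule.coe_add, map_add]
    exact h2
  map_smul' c φ := by
    apply Subtype.ext
    have := clm_comp_diffAt (c • ContinuousLinearMap.id ℂ H) (orbit_mdiff U φ 1) v
    simpa using this

theorem dU_apply (v : GroupLieAlgebra 𝓘(ℝ, E) G) (φ : smoothVectors E U) :
    (dU U v φ : H) = diffAt (fun g : G ↦ (U g : H →L[ℂ] H) φ) 1 v := rfl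

/-- For every curve `γ` in `G` through `1` with velocity `x` there, in particular for
`γ t = exp (t x)`, the vector `dU(x) φ` is the limit of `t⁻¹ (U(γ t) φ - φ)` as `t → 0`. -/
theorem tendsto_dU (v : GroupLieAlgebra 𝓘(ℝ, E) G) (φ : smoothVectors E U) (γ : ℝ → G)
    (h0 : γ 0 = 1) (hγ : MDifferentiableAt 𝓘(ℝ, ℝ) 𝓘(ℝ, E) γ 0)
    (hv : (mfderiv 𝓘(ℝ, ℝ) 𝓘(ℝ, E) γ 0 (1 : ℝ) : E) = v) :
    Filter.Tendsto (fun t : ℝ ↦ (t⁻¹ : ℝ) • ((U (γ t) : H →L[ℂ] H) φ - φ)) (𝓝[≠] 0)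
      (𝓝 (dU U v φ : H)) := by
  have hf : HasMFDerivAt 𝓘(ℝ, E) 𝓘(ℝ, H) (fun g : G ↦ (U g : H →L[ℂ] H) φ) (γ 0)
      (mfderiv 𝓘(ℝ, E) 𝓘(ℝ, H) (fun g : G ↦ (U g : H →L[ℂ] H) φ) (γ 0)) :=
    (orbit_mdiff U φ (γ 0)).hasMFDerivAt
  obtain ⟨L, hL, hL1⟩ : ∃ L : ℝ →L[ℝ] H, HasFDerivAt (fun t : ℝ ↦ (U (γ t) : H →L[ℂ] H) φ) L 0 ∧
      L 1 = diffAt (fun g : G ↦ (U g : H →L[ℂ] H) φ) (γ 0)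
        (mfderiv 𝓘(ℝ, ℝ) 𝓘(ℝ, E) γ 0 (1 : ℝ)) :=
    ⟨_, hasMFDerivAt_iff_hasFDerivAt.1 (hf.comp (0 : ℝ) hγ.hasMFDerivAt), rfl⟩
  have h2 := hasDerivAt_iff_tendsto_slope_zero.1 hL.hasDerivAt
  have h3 : L 1 = (dU U v φ : H) := by
    rw [hL1, dU_apply]
    have h4 : ∀ (g : G) (w : E), γ 0 = g → w = v →
        diffAt (fun g : G ↦ (U g : H →L[ℂ] H) φ) (γ 0) w =
          diffAt (fun g : G ↦ (U g : H →L[ℂ] H) φ) g v := by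
      rintro g w rfl rfl; rfl
    exact h4 1 _ h0 hv
  rw [h3] at h2
  simpa [h0] using h2

/-- `dU` turns brackets into commutators. -/
theorem dU_lie (v w : GroupLieAlgebra 𝓘(ℝ, E) G) [CompleteSpace E] :
    dU U ⁅v, w⁆ = ⁅dU U v, dU U w⁆ := by
  ext φ
  have hs : ∀ u : GroupLieAlgebra 𝓘(ℝ, E) G, (fun g ↦ diffAt (fun g : G ↦ (U g : H →L[ℂ] H) φ) g
      (mulInvariantVectorField u g)) = fun g ↦ (U g : H →L[ℂ] H) (dU U u φ) :=
    fun u ↦ funext fun g ↦ diffAt_orbit U φ u g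
  have h := diffAt_mlieBracket (f := fun g : G ↦ (U g : H →L[ℂ] H) φ) φ.2 1
    (mdifferentiableAt_mulInvariantVectorField v) (mdifferentiableAt_mulInvariantVectorField w)
    (by rw [hs]; exact orbit_mdiff U _ 1) (by rw [hs]; exact orbit_mdiff U _ 1)
  rw [hs, hs] at h
  have e : ∀ u : GroupLieAlgebra 𝓘(ℝ, E) G, mulInvariantVectorField u (1 : G) = u := fun u ↦ by
    have : (fun x : G ↦ 1 * x) = id := funext fun x ↦ one_mul x
    rw [mulInvariantVectorField, this, mfderiv_id]
    rfl
  rw [e, e] at h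
  exact h

attribute [local instance 100] LieRing.ofAssociativeRing LieAlgebra.ofAssociativeAlgebra

/-- The representation `x ↦ dU(x)` of the Lie algebra of `G` on `D^∞(U)`. -/
def dULie [CompleteSpace E] : GroupLieAlgebra 𝓘(ℝ, E) G →ₗ⁅ℝ⁆ Module.End ℂ (smoothVectors E U) where
  toFun := dU U
  map_add' v w := by
    ext φ; exact map_add (diffAt (fun g : G ↦ (U g : H →L[ℂ] H) φ) 1) v w
  map_smul' c v := by
    ext φ; exact map_smul (diffAt (fun g : G ↦ (U g : H →L[ℂ] H) φ) 1) c v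
  map_lie' {v w} := dU_lie U v w

variable (E G) in
/-- The (complex) enveloping algebra of the Lie algebra of `G`. -/
abbrev EnvAlg [CompleteSpace E] :=
  ℂ ⊗[ℝ] UniversalEnvelopingAlgebra ℝ (GroupLieAlgebra 𝓘(ℝ, E) G)

/-- The infinitesimal representation `dU` of the enveloping algebra on `D^∞(U)`: the unital algebra
homomorphism that extends `x ↦ dU(x)`. -/
def infRep [CompleteSpace E] : EnvAlg E G →ₐ[ℂ] Module.End ℂ (smoothVectors E U) :=
  Algebra.TensorProduct.lift (Algebra.ofId ℂ _)
    (UniversalEnvelopingAlgebra.lift ℝ (dULie U))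
    (fun c _ ↦ Algebra.commutes c _)

theorem infRep_ι [CompleteSpace E] (x : GroupLieAlgebra 𝓘(ℝ, E) G) :
    infRep U (1 ⊗ₜ UniversalEnvelopingAlgebra.ι ℝ x) = dU U x := by
  simp [infRep, dULie]

/-- The algebra `dU(𝓔(𝔤))` of operators on `D^∞(U)`. -/
def infAlgebra [CompleteSpace E] : Subalgebra ℂ (Module.End ℂ (smoothVectors E U)) :=
  (infRep U).range

end

end InfRep

namespace OpAlg

noncomputable section

variable {H : Type*} [NormedAddCommGroup H] [InnerProductSpace ℂ H] [CompleteSpace H]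
  {D : Submodule ℂ H}

/-- An operator `D → D` as an unbounded operator in `H` with domain `D`. -/
def toPMap (A : Module.End ℂ D) : H →ₗ.[ℂ] H := ⟨D, D.subtype ∘ₗ A⟩

/-- An unbounded operator is essentially self-adjoint if it is closable and its closure is
self-adjoint. -/
def IsEssentiallySelfAdjoint (T : H →ₗ.[ℂ] H) : Prop :=
  T.IsClosable ∧ IsSelfAdjoint T.closure

variable (H) in
/-- The index set of a fixed orthonormal (Hilbert) basis of `H`. -/
def basisSet : Set H := (exists_hilbertBasis ℂ H).choose

variable (H) in
/-- A fixed orthonormal (Hilbert) basis of `H`, used to compute traces. -/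
def basis : HilbertBasis (basisSet H) ℂ H := (exists_hilbertBasis ℂ H).choose_spec.choose

/-- A bounded operator `T` is trace class if `Tr |T| < ∞`, where `|T| = √(T* T)`. (The terms
`⟨e, |T| e⟩` are nonnegative and their sum does not depend on the orthonormal basis.) -/
def IsTraceClass (T : H →L[ℂ] H) : Prop :=
  Summable fun i ↦ (⟪basis H i, CFC.abs T (basis H i)⟫_ℂ).re

/-- The trace of an everywhere defined operator. It is used only for trace class operators, where
it does not depend on the orthonormal basis. -/
def trace (L : H →ₗ[ℂ] H) : ℂ := ∑' i, ⟪basis H i, L (basis H i)⟫_ℂ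

/-- The product `A T`, where `A` has domain `D` and `T` maps `H` into `D`. -/
def prod (A : Module.End ℂ D) (T : H →L[ℂ] H) (hT : ∀ x, T x ∈ D) : H →ₗ[ℂ] H :=
  D.subtype ∘ₗ A ∘ₗ (T : H →ₗ[ℂ] H).codRestrict D hT

/-- The product `A T` is a (bounded and) trace class operator on `H`. -/
def IsTraceClassProd (A : Module.End ℂ D) (T : H →L[ℂ] H) (hT : ∀ x, T x ∈ D) : Prop :=
  ∃ S : H →L[ℂ] H, (S : H →ₗ[ℂ] H) = prod A T hT ∧ IsTraceClass S

/-- The set `𝒯₁(𝒜)` of trace class operators `T` with `T H ⊆ D` and `T* H ⊆ D` such that `A T` and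
`A T*` are trace class for every `A` in `𝒜`. -/
structure MemT1 (𝒜 : Subalgebra ℂ (Module.End ℂ D)) (T : H →L[ℂ] H) : Prop where
  traceClass : IsTraceClass T
  maps : ∀ x, T x ∈ D
  adjoint_maps : ∀ x, ContinuousLinearMap.adjoint T x ∈ D
  prod_traceClass : ∀ A ∈ 𝒜, IsTraceClassProd A T maps
  prod_adjoint_traceClass : ∀ A ∈ 𝒜, IsTraceClassProd A (ContinuousLinearMap.adjoint T) adjoint_maps

/-- The state space of an operator algebra `𝒜` on `D`: the positive (hence self-adjoint) operators
in `𝒯₁(𝒜)` of trace `1`. -/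
structure State (𝒜 : Subalgebra ℂ (Module.End ℂ D)) where
  op : H →L[ℂ] H
  mem : MemT1 𝒜 op
  positive : op.IsPositive
  trace_eq_one : trace (op : H →ₗ[ℂ] H) = 1

variable {𝒜 : Subalgebra ℂ (Module.End ℂ D)}

/-- The number `Tr (ρ A)`, computed as the trace of the everywhere defined operator `A ρ`. -/
def State.expect (ρ : State 𝒜) (A : Module.End ℂ D) : ℂ := trace (prod A ρ.op ρ.mem.maps)

/-- The weak topology on the state space: the coarsest one for which `ρ ↦ Tr (ρ A)` is continuous
for every `A` in `𝒜`. -/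
instance : TopologicalSpace (State 𝒜) :=
  TopologicalSpace.induced (fun ρ (A : 𝒜) ↦ ρ.expect A) Pi.topologicalSpace

end

end OpAlg

/-! The state space is convex, and `Tr (ρ A)` is affine along segments. If `ρ` is interior to the
level set `Tr (ρ A) = α` and `σ` is any state, then `(1 - t) ρ + t σ` tends weakly to `ρ` as `t →
0`, hence lies in the level set for some `t > 0`; cancelling `t` gives `Tr (σ A) = α`. So an
interior point forces the expectation of `A` to be constant on all states
(`State.expect_eq_of_mem_interior`). For the vector states of unit vectors `φ` in the domain this
says `⟪φ, A φ⟫ = α`, and complex polarization yields `A = α I` (`eq_smul_one_of_inner_eq`).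

The analytic work is the convexity: trace class operators must be closed under linear combinations,
with additive trace. Both follow from factoring a trace class operator into two Hilbert–Schmidt
operators by the polar decomposition (`IsTraceClass.exists_comp`). -/

namespace OpAlg

section

variable {H : Type*} [NormedAddCommGroup H] [InnerProductSpace ℂ H] [CompleteSpace H]

open ContinuousLinearMap InnerProductSpace

/-! ### Hilbert–Schmidt operators. -/

/-- A Hilbert–Schmidt operator, in terms of the fixed orthonormal basis. -/
def IsHilbertSchmidt (T : H →L[ℂ] H) : Prop :=
  Summable fun i ↦ ‖T (basis H i)‖ ^ 2

theorem hasSum_norm_inner_basis_sq (x : H) :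
    HasSum (fun i ↦ ‖⟪basis H i, x⟫_ℂ‖ ^ 2) (‖x‖ ^ 2) := by
  have h := (basis H).hasSum_inner_mul_inner x x
  rw [inner_self_eq_norm_sq_to_K] at h
  have h2 := Complex.hasSum_re h
  convert! h2 using 1
  · funext i
    rw [← inner_conj_symm x, ← Complex.normSq_eq_conj_mul_self, Complex.normSq_eq_norm_sq,
      Complex.ofReal_re]
  · norm_cast

/-- By Parseval both sums equal the double sum of `|⟪e_j, T e_i⟫|²`, taken in the two orders; the
terms are nonnegative, so the order is immaterial. -/
theorem isHilbertSchmidt_adjoint {T : H →L[ℂ] H} (hT : IsHilbertSchmidt T) :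
    IsHilbertSchmidt (adjoint T) := by
  let f : basisSet H × basisSet H → ℝ := fun p ↦ ‖⟪basis H p.2, T (basis H p.1)⟫_ℂ‖ ^ 2
  have hf0 : 0 ≤ f := fun p ↦ sq_nonneg _
  have hf : Summable f := by
    refine (summable_prod_of_nonneg hf0).2 ⟨fun i ↦ ?_, ?_⟩
    · exact (hasSum_norm_inner_basis_sq (T (basis H i))).summable
    · refine hT.congr fun i ↦ ?_
      exact ((hasSum_norm_inner_basis_sq (T (basis H i))).tsum_eq).symm
  have h := ((summable_prod_of_nonneg fun p ↦ hf0 p.swap).1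
    ((Equiv.prodComm _ _).summable_iff.2 hf)).2
  refine h.congr fun i ↦ ?_
  rw [← (hasSum_norm_inner_basis_sq _).tsum_eq]
  refine tsum_congr fun j ↦ ?_
  change ‖⟪basis H i, T (basis H j)⟫_ℂ‖ ^ 2 = _
  rw [adjoint_inner_right, ← inner_conj_symm, RCLike.norm_conj]

theorem IsHilbertSchmidt.comp_left {T : H →L[ℂ] H} (hT : IsHilbertSchmidt T) (B : H →L[ℂ] H) :
    IsHilbertSchmidt (B ∘L T) := by
  refine Summable.of_nonneg_of_le (fun i ↦ by positivity) (fun i ↦ ?_) (hT.mul_left (‖B‖ ^ 2))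
  rw [← mul_pow]
  gcongr
  exact B.le_opNorm _

theorem isHilbertSchmidt_rankOne (x y : H) : IsHilbertSchmidt (rankOne ℂ x y) := by
  refine ((hasSum_norm_inner_basis_sq y).summable.mul_right (‖x‖ ^ 2)).congr fun i ↦ ?_
  rw [rankOne_apply, norm_smul, mul_pow, ← inner_conj_symm, RCLike.norm_conj]

/-- Moving `P` to the left gives `⟪P* e_i, Q e_i⟫`, which Cauchy–Schwarz bounds by `‖P* e_i‖² + ‖Q
e_i‖²`. -/
theorem IsHilbertSchmidt.summable_inner_comp {P Q : H →L[ℂ] H} (hP : IsHilbertSchmidt P)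
    (hQ : IsHilbertSchmidt Q) : Summable fun i ↦ ⟪basis H i, P (Q (basis H i))⟫_ℂ := by
  refine Summable.of_norm_bounded ((isHilbertSchmidt_adjoint hP).add hQ) fun i ↦ ?_
  rw [← adjoint_inner_left]
  refine (norm_inner_le_norm _ _).trans ?_
  nlinarith [sq_nonneg (‖ContinuousLinearMap.adjoint P (basis H i)‖ - ‖Q (basis H i)‖),
    sq_nonneg (‖ContinuousLinearMap.adjoint P (basis H i)‖), sq_nonneg ‖Q (basis H i)‖]

/-! ### Absolute value and polar decomposition. -/

theorem adjoint_abs (T : H →L[ℂ] H) : adjoint (CFC.abs T) = CFC.abs T :=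
  ((nonneg_iff_isPositive _).1 (CFC.abs_nonneg T)).isSelfAdjoint

theorem norm_abs_apply (T : H →L[ℂ] H) (x : H) : ‖CFC.abs T x‖ = ‖T x‖ := by
  have h : ⟪CFC.abs T x, CFC.abs T x⟫_ℂ = ⟪T x, T x⟫_ℂ := by
    have h2 : CFC.abs T (CFC.abs T x) = ContinuousLinearMap.adjoint T (T x) :=
      congrArg (fun S : H →L[ℂ] H ↦ S x) (CFC.abs_mul_abs T)
    rw [← adjoint_inner_left, adjoint_abs, h2, adjoint_inner_left]
  rw [inner_self_eq_norm_sq_to_K, inner_self_eq_norm_sq_to_K] at h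
  have h2 : ‖CFC.abs T x‖ ^ 2 = ‖T x‖ ^ 2 := by exact_mod_cast h
  exact (sq_eq_sq₀ (norm_nonneg _) (norm_nonneg _)).1 h2

/-- Douglas factorization through an operator of the same norm. -/
theorem exists_contraction_comp_eq {T P : H →L[ℂ] H} (h : ∀ x, ‖T x‖ = ‖P x‖) :
    ∃ V : H →L[ℂ] H, ‖V‖ ≤ 1 ∧ V ∘L P = T := by
  let K : Submodule ℂ H := (LinearMap.range (P : H →ₗ[ℂ] H)).topologicalClosure
  have : CompleteSpace K := (Submodule.isClosed_topologicalClosure _).completeSpace_coe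
  have hK : ∀ x, P x ∈ K := fun x ↦ Submodule.le_topologicalClosure _ ⟨x, rfl⟩
  let e : H →ₗ[ℂ] K := (P : H →ₗ[ℂ] H).codRestrict K hK
  have he : DenseRange e := by
    rw [DenseRange, Subtype.dense_iff]
    intro x hx
    rw [← Set.range_comp]
    exact hx
  have hb : ∀ x, ‖(T : H →ₗ[ℂ] H) x‖ ≤ 1 * ‖e x‖ := fun x ↦ by
    rw [one_mul]; exact (h x).le
  -- `V` extends `P x ↦ T x` from the range of `P` to its closure `K` and vanishes on the orthogonal
  -- complement of `K`; equality of norms makes this well defined and contractive.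
  refine ⟨(LinearMap.extendOfNorm (T : H →ₗ[ℂ] H) e) ∘L K.orthogonalProjectionOnto, ?_, ?_⟩
  · refine opNorm_le_bound _ zero_le_one fun x ↦ ?_
    refine (LinearMap.norm_extendOfNorm_apply_le he 1 hb _).trans ?_
    rw [one_mul, one_mul]
    exact K.norm_orthogonalProjectionOnto_apply_le x
  · ext x
    have h1 : K.orthogonalProjectionOnto (P x) = e x :=
      Submodule.orthogonalProjectionOnto_mem_subspace_eq_self (e x)
    rw [comp_apply, comp_apply, h1]
    exact LinearMap.extendOfNorm_eq he ⟨1, hb⟩ x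

/-- Expanding the square, `‖V* V y - y‖² = ‖V* V y‖² - 2 ‖V y‖² + ‖y‖²`, which is at most `0`
because `‖V* V y‖ ≤ ‖V y‖ = ‖y‖`. -/
theorem adjoint_apply_apply_of_norm_eq {V : H →L[ℂ] H} (hV : ‖V‖ ≤ 1) {y : H}
    (hy : ‖V y‖ = ‖y‖) : adjoint V (V y) = y := by
  have h1 : ‖adjoint V (V y)‖ ≤ ‖y‖ := by
    refine (le_of_opNorm_le _ (c := 1) (by simpa using hV) _).trans ?_
    rw [one_mul, hy]
  have h2 : RCLike.re ⟪adjoint V (V y), y⟫_ℂ = ‖y‖ ^ 2 := by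
    rw [adjoint_inner_left, inner_self_eq_norm_sq, hy]
  have h3 := norm_sub_sq (𝕜 := ℂ) (adjoint V (V y)) y
  rw [h2] at h3
  have h4 : ‖adjoint V (V y) - y‖ ^ 2 ≤ 0 := by
    nlinarith [norm_nonneg (adjoint V (V y))]
  rw [← sub_eq_zero, ← norm_eq_zero]
  exact pow_eq_zero_iff two_ne_zero |>.1 (le_antisymm h4 (sq_nonneg _))

/-- Polar decomposition. -/
theorem exists_polar (T : H →L[ℂ] H) :
    ∃ V : H →L[ℂ] H, V ∘L CFC.abs T = T ∧ adjoint V ∘L T = CFC.abs T := by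
  obtain ⟨V, hV, hVT⟩ := exists_contraction_comp_eq fun x ↦ (norm_abs_apply T x).symm
  refine ⟨V, hVT, ?_⟩
  ext x
  have h : V (CFC.abs T x) = T x := congrArg (fun S : H →L[ℂ] H ↦ S x) hVT
  rw [comp_apply, ← h]
  exact adjoint_apply_apply_of_norm_eq hV (by rw [h, norm_abs_apply])

/-! ### Trace class operators and the trace. -/

/-- With `R = |T|^(1/2)` and `T = V |T|`, the factors are `V R` and `R`; `R` is Hilbert–Schmidt
since `‖R e_i‖² = ⟪e_i, |T| e_i⟫`. -/
theorem IsTraceClass.exists_comp {T : H →L[ℂ] H} (hT : IsTraceClass T) :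
    ∃ P Q : H →L[ℂ] H, IsHilbertSchmidt P ∧ IsHilbertSchmidt Q ∧ T = P ∘L Q := by
  obtain ⟨V, hV, -⟩ := exists_polar T
  obtain ⟨R, hR, hRR⟩ : ∃ R : H →L[ℂ] H, 0 ≤ R ∧ R ∘L R = CFC.abs T :=
    ⟨_, CFC.sqrt_nonneg _, CFC.sqrt_mul_sqrt_self _ (CFC.abs_nonneg T)⟩
  have hRa : adjoint R = R := ((nonneg_iff_isPositive _).1 hR).isSelfAdjoint
  have hRS : IsHilbertSchmidt R := by
    refine hT.congr fun i ↦ ?_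
    rw [← hRR, comp_apply, ← adjoint_inner_left, hRa]
    exact inner_self_eq_norm_sq (𝕜 := ℂ) _
  exact ⟨V ∘L R, R, hRS.comp_left V, hRS, by rw [comp_assoc, hRR, hV]⟩

/-- The absolute value of a sum is not controlled termwise, but the polar decomposition writes it as
`V* P Q + V* P' Q'`, and each summand is again a product of Hilbert–Schmidt operators. -/
theorem IsHilbertSchmidt.isTraceClass_comp_add_comp {P Q P' Q' : H →L[ℂ] H}
    (hP : IsHilbertSchmidt P) (hQ : IsHilbertSchmidt Q) (hP' : IsHilbertSchmidt P')
    (hQ' : IsHilbertSchmidt Q') : IsTraceClass (P ∘L Q + P' ∘L Q') := by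
  obtain ⟨V, -, hV⟩ := exists_polar (P ∘L Q + P' ∘L Q')
  have h := ((hP.comp_left (adjoint V)).summable_inner_comp hQ).add
    ((hP'.comp_left (adjoint V)).summable_inner_comp hQ')
  refine (Complex.hasSum_re h.hasSum).summable.congr fun i ↦ ?_
  rw [← hV]
  simp

theorem isHilbertSchmidt_zero : IsHilbertSchmidt (0 : H →L[ℂ] H) := by
  simp [IsHilbertSchmidt]

theorem IsHilbertSchmidt.isTraceClass_comp {P Q : H →L[ℂ] H}
    (hP : IsHilbertSchmidt P) (hQ : IsHilbertSchmidt Q) : IsTraceClass (P ∘L Q) := by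
  simpa using hP.isTraceClass_comp_add_comp hQ isHilbertSchmidt_zero isHilbertSchmidt_zero

theorem IsTraceClass.smul_add_smul {S T : H →L[ℂ] H} (hS : IsTraceClass S) (hT : IsTraceClass T)
    (a b : ℂ) : IsTraceClass (a • S + b • T) := by
  obtain ⟨P, Q, hP, hQ, rfl⟩ := hS.exists_comp
  obtain ⟨P', Q', hP', hQ', rfl⟩ := hT.exists_comp
  simpa using (hP.comp_left (a • .id ℂ H)).isTraceClass_comp_add_comp hQ
    (hP'.comp_left (b • .id ℂ H)) hQ'

theorem IsTraceClass.summable_inner {T : H →L[ℂ] H} (hT : IsTraceClass T) :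
    Summable fun i ↦ ⟪basis H i, T (basis H i)⟫_ℂ := by
  obtain ⟨P, Q, hP, hQ, rfl⟩ := hT.exists_comp
  exact hP.summable_inner_comp hQ

theorem isTraceClass_rankOne (x : H) {y : H} (hy : ‖y‖ = 1) : IsTraceClass (rankOne ℂ x y) := by
  -- For a unit vector `y`, `|x⟩⟨y| = |x⟩⟨y| ∘ |y⟩⟨y|`.
  have h := (isHilbertSchmidt_rankOne x y).isTraceClass_comp (isHilbertSchmidt_rankOne y y)
  simpa [rankOne_comp_rankOne, inner_self_eq_norm_sq_to_K, hy] using h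

theorem trace_smul_add_smul {S T : H →L[ℂ] H} (hS : IsTraceClass S) (hT : IsTraceClass T)
    (a b : ℂ) : trace (a • (S : H →ₗ[ℂ] H) + b • (T : H →ₗ[ℂ] H)) =
      a * trace (S : H →ₗ[ℂ] H) + b * trace (T : H →ₗ[ℂ] H) := by
  have h := (hS.summable_inner.hasSum.mul_left a).add (hT.summable_inner.hasSum.mul_left b)
  rw [trace, trace, trace]
  simpa [inner_add_right] using h.tsum_eq

theorem trace_rankOne (x y : H) : trace (rankOne ℂ x y : H →ₗ[ℂ] H) = ⟪y, x⟫_ℂ := by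
  rw [trace, ← (basis H).tsum_inner_mul_inner y x]
  refine tsum_congr fun i ↦ ?_
  simp

/-! ### Convexity of the state space. -/

variable {D : Submodule ℂ H} {𝒜 : Subalgebra ℂ (Module.End ℂ D)}

theorem prod_smul_add_smul (A : Module.End ℂ D) {S T : H →L[ℂ] H} (hS : ∀ x, S x ∈ D)
    (hT : ∀ x, T x ∈ D) (a b : ℂ) (hST : ∀ x, (a • S + b • T) x ∈ D) :
    prod A (a • S + b • T) hST = a • prod A S hS + b • prod A T hT := by
  ext x
  have h : (⟨(a • S + b • T) x, hST x⟩ : D) = a • ⟨S x, hS x⟩ + b • ⟨T x, hT x⟩ := rfl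
  change (A ⟨(a • S + b • T) x, hST x⟩ : H) =
    a • (A ⟨S x, hS x⟩ : H) + b • (A ⟨T x, hT x⟩ : H)
  rw [h, map_add, map_smul, map_smul]
  rfl

theorem IsTraceClassProd.smul_add_smul {A : Module.End ℂ D} {S T : H →L[ℂ] H}
    {hS : ∀ x, S x ∈ D} {hT : ∀ x, T x ∈ D} (h : IsTraceClassProd A S hS)
    (h' : IsTraceClassProd A T hT) (a b : ℂ) (hST : ∀ x, (a • S + b • T) x ∈ D) :
    IsTraceClassProd A (a • S + b • T) hST := by
  obtain ⟨S', hS', hS''⟩ := h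
  obtain ⟨T', hT', hT''⟩ := h'
  refine ⟨a • S' + b • T', ?_, hS''.smul_add_smul hT'' a b⟩
  rw [prod_smul_add_smul A hS hT, ← hS', ← hT']
  rfl

theorem memT1_of_adjoint_eq {T : H →L[ℂ] H} (hT : adjoint T = T) (htc : IsTraceClass T)
    (hm : ∀ x, T x ∈ D) (hp : ∀ A ∈ 𝒜, IsTraceClassProd A T hm) : MemT1 𝒜 T where
  traceClass := htc
  maps := hm
  adjoint_maps := by rwa [hT]
  prod_traceClass := hp
  prod_adjoint_traceClass := by simpa only [hT] using hp

theorem isPositive_one_sub_smul_add_smul {S T : H →L[ℂ] H} (hS : S.IsPositive)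
    (hT : T.IsPositive) (t : unitInterval) :
    (((1 - t : ℝ) : ℂ) • S + ((t : ℝ) : ℂ) • T).IsPositive :=
  (hS.smul_of_nonneg (by exact_mod_cast sub_nonneg.2 t.2.2)).add
    (hT.smul_of_nonneg (by exact_mod_cast t.2.1))

/-- The convex combination `(1 - t) ρ + t σ` of two states. -/
noncomputable def State.mix (ρ σ : State 𝒜) (t : unitInterval) : State 𝒜 where
  op := ((1 - t : ℝ) : ℂ) • ρ.op + ((t : ℝ) : ℂ) • σ.op
  mem := by
    have hm : ∀ x, (((1 - t : ℝ) : ℂ) • ρ.op + ((t : ℝ) : ℂ) • σ.op) x ∈ D := fun x ↦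
      D.add_mem (D.smul_mem _ (ρ.mem.maps x)) (D.smul_mem _ (σ.mem.maps x))
    exact memT1_of_adjoint_eq
      (isPositive_one_sub_smul_add_smul ρ.positive σ.positive t).isSelfAdjoint
      (ρ.mem.traceClass.smul_add_smul σ.mem.traceClass _ _) hm
      fun A hA ↦ (ρ.mem.prod_traceClass A hA).smul_add_smul (σ.mem.prod_traceClass A hA) _ _ _
  positive := isPositive_one_sub_smul_add_smul ρ.positive σ.positive t
  trace_eq_one := by
    have h := trace_smul_add_smul ρ.mem.traceClass σ.mem.traceClass
      ((1 - t : ℝ) : ℂ) ((t : ℝ) : ℂ)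
    rw [ρ.trace_eq_one, σ.trace_eq_one] at h
    refine Eq.trans h ?_
    push_cast
    ring

theorem State.expect_mix (ρ σ : State 𝒜) (t : unitInterval) {A : Module.End ℂ D} (hA : A ∈ 𝒜) :
    (ρ.mix σ t).expect A = ((1 - t : ℝ) : ℂ) * ρ.expect A + ((t : ℝ) : ℂ) * σ.expect A := by
  obtain ⟨S, hS, hS'⟩ := ρ.mem.prod_traceClass A hA
  obtain ⟨T, hT, hT'⟩ := σ.mem.prod_traceClass A hA
  have h := trace_smul_add_smul hS' hT' ((1 - t : ℝ) : ℂ) ((t : ℝ) : ℂ)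
  rw [hS, hT] at h
  rw [State.expect, State.expect, State.expect, ← h]
  exact congrArg trace (prod_smul_add_smul A ρ.mem.maps σ.mem.maps _ _ _)

/-- The topology is induced by the expectations, and each of these is affine in `t` along the
segment. -/
theorem State.continuous_mix (ρ σ : State 𝒜) : Continuous (ρ.mix σ) := by
  refine continuous_induced_rng.2 (continuous_pi fun A ↦ ?_)
  simp only [Function.comp_def, State.expect_mix ρ σ _ A.2]
  fun_prop

theorem State.mix_zero (ρ σ : State 𝒜) : ρ.mix σ 0 = ρ := by
  cases ρ
  simp [State.mix]

/-! ### Vector states. -/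

theorem prod_rankOne (A : Module.End ℂ D) (φ : D) (y : H) (h : ∀ x, rankOne ℂ (φ : H) y x ∈ D) :
    prod A (rankOne ℂ (φ : H) y) h = (rankOne ℂ (A φ : H) y : H →ₗ[ℂ] H) := by
  ext x
  change (A (⟪y, x⟫_ℂ • φ) : H) = ⟪y, x⟫_ℂ • (A φ : H)
  rw [map_smul]
  rfl

/-- The vector state of a unit vector in the domain. -/
noncomputable def vectorState (𝒜 : Subalgebra ℂ (Module.End ℂ D)) (φ : D) (hφ : ‖φ‖ = 1) :
    State 𝒜 where
  op := rankOne ℂ (φ : H) (φ : H)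
  mem := memT1_of_adjoint_eq (adjoint_rankOne _ _) (isTraceClass_rankOne _ hφ)
    (fun _ ↦ D.smul_mem _ φ.2)
    fun A _ ↦ ⟨rankOne ℂ (A φ : H) (φ : H), (prod_rankOne A φ _ _).symm,
      isTraceClass_rankOne _ hφ⟩
  positive := isPositive_rankOne_self _
  trace_eq_one := by
    have h : ‖(φ : H)‖ = 1 := hφ
    rw [trace_rankOne, inner_self_eq_norm_sq_to_K, h]
    simp

theorem expect_vectorState (φ : D) (hφ : ‖φ‖ = 1) (A : Module.End ℂ D) :
    (vectorState 𝒜 φ hφ).expect A = ⟪φ, A φ⟫_ℂ :=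
  (congrArg trace (prod_rankOne A φ _ _)).trans (trace_rankOne _ _)

/-! ### Constancy of the expectation and the conclusion. -/

/-- If the level set of an expectation functional has an interior point, then the functional is
constant on the state space. -/
theorem State.expect_eq_of_mem_interior {A : Module.End ℂ D} (hA : A ∈ 𝒜) {c : ℂ} {ρ : State 𝒜}
    (hρ : ρ ∈ interior {ρ : State 𝒜 | ρ.expect A = c}) (σ : State 𝒜) : σ.expect A = c := by
  -- The weights `1 / (n + 1)` tend to `0` but stay positive, so that they can be cancelled at the
  -- end.
  let t : ℕ → unitInterval := fun n ↦ ⟨1 / ((n : ℝ) + 1), by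
    rw [one_div]
    exact ⟨by positivity, inv_le_one_of_one_le₀ (by linarith [n.cast_nonneg (α := ℝ)])⟩⟩
  have ht : Filter.Tendsto t Filter.atTop (𝓝 0) :=
    tendsto_subtype_rng.2 tendsto_one_div_add_atTop_nhds_zero_nat
  have h1 : Filter.Tendsto (fun n ↦ ρ.mix σ (t n)) Filter.atTop (𝓝 ρ) := by
    have h := ((ρ.continuous_mix σ).tendsto 0).comp ht
    rwa [ρ.mix_zero σ] at h
  obtain ⟨n, hn⟩ := (h1.eventually (mem_interior_iff_mem_nhds.1 hρ)).exists
  have hρc : ρ.expect A = c := by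
    have h := interior_subset hρ
    exact h
  have hn' : (ρ.mix σ (t n)).expect A = c := hn
  rw [ρ.expect_mix σ (t n) hA, hρc] at hn'
  have htn : ((t n : ℝ) : ℂ) ≠ 0 := by
    have h : (0 : ℝ) < t n := by
      change (0 : ℝ) < 1 / ((n : ℝ) + 1)
      positivity
    exact_mod_cast h.ne'
  refine mul_left_cancel₀ htn ?_
  push_cast at hn'
  linear_combination hn'

/-- An operator on `D` whose expectation in every vector state is `c` is the scalar `c`. -/
theorem eq_smul_one_of_inner_eq {A : Module.End ℂ D} {c : ℂ}
    (h : ∀ φ : D, ‖φ‖ = 1 → ⟪φ, A φ⟫_ℂ = c) : A = c • 1 := by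
  -- Over `ℂ` a linear operator with vanishing quadratic form is zero, by polarization; the values
  -- on unit vectors extend to all of `D` by scaling.
  rw [← sub_eq_zero, ← inner_map_self_eq_zero]
  intro φ
  rcases eq_or_ne φ 0 with rfl | hφ
  · simp
  have hn : (‖φ‖ : ℂ) ≠ 0 := by exact_mod_cast norm_ne_zero_iff.2 hφ
  have h1 := h ((‖φ‖ : ℂ)⁻¹ • φ) (by
    rw [norm_smul, norm_inv, Complex.norm_real, norm_norm]
    exact inv_mul_cancel₀ (norm_ne_zero_iff.2 hφ))
  rw [map_smul, inner_smul_left, inner_smul_right] at h1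
  have h3 : ⟪φ, A φ⟫_ℂ = c * (‖φ‖ : ℂ) ^ 2 := by
    simp only [map_inv₀, Complex.conj_ofReal] at h1
    field_simp at h1
    rw [h1, mul_comm]
  rw [← inner_conj_symm]
  simp [inner_sub_right, inner_smul_right, h3]

end

end OpAlg

theorem corollary11 {n : ℕ} {G : Type*} [TopologicalSpace G]
    [ChartedSpace (EuclideanSpace ℝ (Fin n)) G] [Group G]
    [LieGroup 𝓘(ℝ, EuclideanSpace ℝ (Fin n)) ∞ G]
    {H : Type*} [NormedAddCommGroup H] [InnerProductSpace ℂ H] [CompleteSpace H]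
    [TopologicalSpace.SeparableSpace H]
    (U : G →* unitary (H →L[ℂ] H))
    (hU : ∀ φ : H, Continuous fun g : G ↦ (U g : H →L[ℂ] H) φ)
    (A : Module.End ℂ (InfRep.smoothVectors (EuclideanSpace ℝ (Fin n)) U))
    (hA : A ∈ InfRep.infAlgebra U)
    (hess : OpAlg.IsEssentiallySelfAdjoint (OpAlg.toPMap A))
    (α : ℝ) (hα : A ≠ (α : ℂ) • 1) :
    interior {ρ : OpAlg.State (InfRep.infAlgebra U) | ρ.expect A = (α : ℂ)} = ∅ := by
  refine Set.eq_empty_iff_forall_notMem.2 fun ρ hρ ↦ hα ?_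
  refine OpAlg.eq_smul_one_of_inner_eq fun φ hφ ↦ ?_
  rw [← OpAlg.expect_vectorState (𝒜 := InfRep.infAlgebra U) φ hφ A]
  exact OpAlg.State.expect_eq_of_mem_interior hA hρ _
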